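/- Let $\mathbb D=\{z\in\mathbb C:|z|<1\}$ and let $\mathcal S^*_{\mathcal B}$ be the class of functions $f$ analytic on $\mathbb D$, with expansion $f(z)=z+\sum_{n\ge 2}a_nz^n$ and $f(z)\neq 0$ for $0<|z|<1$, for which there is an analytic function $w:\mathbb D\to\mathbb C$ with $w(0)=0$ and $|w(z)|\le|z|$ such that $$\frac{zf'(z)}{f(z)}=\sqrt{1+\tanh w(z)}\qquad(z\in\mathbb D),$$ where the square root is the principal branch and the left-hand side is given its limiting value $1$ at $z=0$. For $f\in\mathcal S^*_{\mathcal B}$, put $a_1=1$ and let $$H_4(1)=\det\begin{pmatrix}a_1&a_2&a_3&a_4\\a_2&a_3&a_4&a_5\\a_3&a_4&a_5&a_6\\a_4&a_5&a_6&a_7\end{pmatrix}$$ be its fourth-order Hankel determinant. **Theorem.** If $f\in\mathcal S^*_{\mathcal B}$, then $|H_4(1)|\le 0.169251$. -/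

import Mathlib

open Metric

noncomputable section

/-- The class `𝒜`: functions analytic on the open unit disk with `f 0 = 0` and `f' 0 = 1`, i.e.
`f z = z + a₂ z² + a₃ z³ + ⋯`. (Values outside the disk are irrelevant.) -/
def ClassA : Set (ℂ → ℂ) :=
  {f | DifferentiableOn ℂ f (ball 0 1) ∧ f 0 = 0 ∧ deriv f 0 = 1}

/-- Schwarz functions: analytic on the open unit disk, `w 0 = 0` and `|w z| ≤ |z|`. -/
def IsSchwarzFunction (w : ℂ → ℂ) : Prop :=
  DifferentiableOn ℂ w (ball 0 1) ∧ w 0 = 0 ∧ ∀ z ∈ ball (0 : ℂ) 1, ‖w z‖ ≤ ‖z‖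

/-- Subordination `h ≺ g` on the open unit disk: `h = g ∘ w` for some Schwarz function `w`. -/
def Subordinate (h g : ℂ → ℂ) : Prop :=
  ∃ w : ℂ → ℂ, IsSchwarzFunction w ∧ ∀ z ∈ ball (0 : ℂ) 1, h z = g (w z)

/-- The quotient `z f'(z) / f(z)`, with its removable singularity at the origin filled by the
limit `1` (the limit for every `f` in `ClassA`). -/
def starlikeQuotient (f : ℂ → ℂ) : ℂ → ℂ :=
  Function.update (fun z => z * deriv f z / f z) 0 1

/-- The function `√(1 + tanh z)` (principal branch), mapping the disk to a bean-shaped domain. -/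
def beanFunction (z : ℂ) : ℂ := Complex.sqrt (1 + Complex.tanh z)

/-- The class `𝒮*_ℬ`: those `f` in `𝒜` for which `z f'(z) / f(z)` is defined on the disk
(`f` has no zero besides the origin) and is subordinate to `√(1 + tanh z)`. -/
def StarlikeBean : Set (ℂ → ℂ) :=
  {f | f ∈ ClassA ∧ (∀ z ∈ ball (0 : ℂ) 1, z ≠ 0 → f z ≠ 0) ∧
    Subordinate (starlikeQuotient f) beanFunction}

/-- The Taylor coefficient `aₙ` of `f` at the origin. -/
def taylorCoeff (f : ℂ → ℂ) (n : ℕ) : ℂ := iteratedDeriv n f 0 / (n.factorial : ℂ)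

/-- The Hankel determinant `H_q(n)`: the determinant of the `q × q` matrix whose entry in row `i`
and column `j` (counted from `0`) is `a_{n+i+j}`. -/
def hankelDet (f : ℂ → ℂ) (q n : ℕ) : ℂ :=
  (Matrix.of fun i j : Fin q => taylorCoeff f (n + (i : ℕ) + (j : ℕ))).det

end

/-!
Write `φ` for the bean function and `f = z g`. If `z f' / f = φ ∘ w`, then `g' = g Q` with
`Q = (φ ∘ w - 1) / z`. The squared coefficients of `Q` sum to at most those of `φ - 1`
(Rogosinski's inequality), so Cauchy–Schwarz in the recursion
`(n + 1) g_{n+1} = ∑ g_k Q_{n-k}` majorizes `|g_n|²` by the solution of a linear recursion.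
Hadamard's inequality involves only these squared moduli and bounds `|H₄(1)|`: the differential
equation `2 φ' = 2 φ - φ³` shows that the first six squared coefficients of `φ - 1` sum to at most
`9 / 25`, which gives `|H₄(1)| < 0.168`.
-/

section TaylorSeries

open Filter Topology PowerSeries

/-- The Taylor series at the origin, as a formal power series. It depends only on the germ of `f`,
and is multiplicative and compatible with derivatives on germs of analytic functions. -/
noncomputable def taylorSeries (f : ℂ → ℂ) : ℂ⟦X⟧ := PowerSeries.mk (taylorCoeff f)

@[simp] lemma coeff_taylorSeries (f : ℂ → ℂ) (n : ℕ) :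
    coeff n (taylorSeries f) = taylorCoeff f n :=
  coeff_mk n _

lemma taylorCoeff_zero (f : ℂ → ℂ) : taylorCoeff f 0 = f 0 := by
  simp [taylorCoeff]

lemma taylorSeries_congr {f g : ℂ → ℂ} (h : f =ᶠ[𝓝 0] g) : taylorSeries f = taylorSeries g := by
  ext n
  simp [taylorCoeff, h.iteratedDeriv_eq n]

lemma taylorSeries_const (c : ℂ) : taylorSeries (fun _ => c) = C c := by
  ext n
  simp only [coeff_taylorSeries, taylorCoeff, iteratedDeriv_const, coeff_C]
  split_ifs with h <;> simp [h]

lemma taylorSeries_id : taylorSeries (fun z => z) = X := by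
  ext n
  simp only [coeff_taylorSeries, taylorCoeff, iteratedDeriv_fun_id_zero, coeff_X]
  split_ifs with h <;> simp [h]

lemma taylorSeries_add {f g : ℂ → ℂ} (hf : AnalyticAt ℂ f 0) (hg : AnalyticAt ℂ g 0) :
    taylorSeries (fun z => f z + g z) = taylorSeries f + taylorSeries g := by
  ext n
  simp only [coeff_taylorSeries, map_add, taylorCoeff,
    iteratedDeriv_fun_add hf.contDiffAt hg.contDiffAt, add_div]

lemma taylorSeries_mul {f g : ℂ → ℂ} (hf : AnalyticAt ℂ f 0) (hg : AnalyticAt ℂ g 0) :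
    taylorSeries (fun z => f z * g z) = taylorSeries f * taylorSeries g := by
  ext n
  simp only [coeff_taylorSeries, taylorCoeff, coeff_mul,
    iteratedDeriv_fun_mul hf.contDiffAt hg.contDiffAt,
    Finset.Nat.sum_antidiagonal_eq_sum_range_succ_mk, Finset.sum_div]
  refine Finset.sum_congr rfl fun i hi => ?_
  rw [Nat.cast_choose _ (by grind)]
  field_simp [Nat.factorial_ne_zero]

lemma taylorSeries_id_mul {f : ℂ → ℂ} (hf : AnalyticAt ℂ f 0) :
    taylorSeries (fun z => z * f z) = X * taylorSeries f := by
  rw [taylorSeries_mul (f := fun z => z) analyticAt_id hf, taylorSeries_id]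

lemma taylorSeries_deriv (f : ℂ → ℂ) :
    taylorSeries (deriv f) = d⁄dX ℂ (taylorSeries f) := by
  ext n
  rw [coeff_derivative]
  simp only [coeff_taylorSeries, taylorCoeff, ← iteratedDeriv_succ', Nat.factorial_succ]
  have : (n : ℂ) + 1 ≠ 0 := n.cast_add_one_ne_zero
  push_cast
  field_simp [Nat.factorial_ne_zero]

lemma taylorSeries_polynomial_eval (p : Polynomial ℂ) :
    taylorSeries (fun z => p.eval z) = p := by
  have analyticAt_eval (p : Polynomial ℂ) : AnalyticAt ℂ (fun z => p.eval z) 0 :=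
    p.differentiable.analyticAt 0
  induction p using Polynomial.induction_on with
  | C a => simpa using taylorSeries_const a
  | add p q hp hq =>
    simp only [Polynomial.eval_add, Polynomial.coe_add,
      taylorSeries_add (analyticAt_eval p) (analyticAt_eval q), hp, hq]
  | monomial n a ih =>
    have eval_eq (z : ℂ) : (Polynomial.C a * Polynomial.X ^ (n + 1)).eval z =
        z * (Polynomial.C a * Polynomial.X ^ n).eval z := by
      simp only [Polynomial.eval_C_mul, Polynomial.eval_pow, Polynomial.eval_X]
      ring
    simp only [eval_eq, taylorSeries_id_mul (analyticAt_eval _), ih]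
    push_cast
    ring

lemma analyticAt_dslope {f : ℂ → ℂ} (hf : AnalyticAt ℂ f 0) : AnalyticAt ℂ (dslope f 0) 0 := by
  obtain ⟨s, hs, hd⟩ := hf.exists_mem_nhds_analyticOnNhd
  exact ((Complex.differentiableOn_dslope hs).2 hd.differentiableOn).analyticAt hs

lemma eq_add_mul_dslope (f : ℂ → ℂ) (z : ℂ) : f z = f 0 + z * dslope f 0 z := by
  simpa using (add_eq_of_eq_sub' (sub_smul_dslope f 0 z)).symm

lemma taylorSeries_eq_C_add_X_mul {f : ℂ → ℂ} (hf : AnalyticAt ℂ f 0) :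
    taylorSeries f = C (f 0) + X * taylorSeries (dslope f 0) := by
  have hd := analyticAt_dslope hf
  rw [← taylorSeries_id_mul hd, ← taylorSeries_const,
    ← taylorSeries_add analyticAt_const (g := fun z => z * dslope f 0 z) (analyticAt_id.mul hd)]
  exact congrArg taylorSeries (funext (eq_add_mul_dslope f))

lemma taylorCoeff_dslope {f : ℂ → ℂ} (hf : AnalyticAt ℂ f 0) (n : ℕ) :
    taylorCoeff (dslope f 0) n = taylorCoeff f (n + 1) := by
  simpa [coeff_succ_X_mul, coeff_C] using
    congrArg (coeff (n + 1)) (taylorSeries_eq_C_add_X_mul hf).symm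

lemma taylorSeries_comp {h w : ℂ → ℂ} (hh : AnalyticAt ℂ h 0) (hw : AnalyticAt ℂ w 0)
    (hw0 : w 0 = 0) :
    taylorSeries (fun z => h (w z)) =
      C (h 0) + X * (taylorSeries (dslope w 0) * taylorSeries fun z => dslope h 0 (w z)) := by
  have hd : AnalyticAt ℂ (fun z => dslope h 0 (w z)) 0 :=
    AnalyticAt.fun_comp (by simpa only [hw0] using analyticAt_dslope hh) hw
  have series_w : taylorSeries w = X * taylorSeries (dslope w 0) := by
    rw [taylorSeries_eq_C_add_X_mul hw, hw0, map_zero, zero_add]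
  calc taylorSeries (fun z => h (w z))
    _ = taylorSeries (fun z => h 0 + w z * dslope h 0 (w z)) :=
      congrArg taylorSeries (funext fun z => eq_add_mul_dslope h (w z))
    _ = C (h 0) + X * (taylorSeries (dslope w 0) * taylorSeries fun z => dslope h 0 (w z)) := by
      rw [taylorSeries_add analyticAt_const (hw.fun_mul hd), taylorSeries_const,
        taylorSeries_mul hw hd, series_w, mul_assoc]

end TaylorSeries

section CircleAverage

open Filter PowerSeries Real Topology

variable {r : ℝ}

lemma circleAverage_sq_norm_const_add_mul {G : ℂ → ℂ} (hr : 0 < r)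
    (hG : DiffContOnCl ℂ G (ball 0 r)) (c : ℂ) :
    circleAverage (fun z => ‖c + z * G z‖ ^ 2) 0 r =
      ‖c‖ ^ 2 + r ^ 2 * circleAverage (fun z => ‖G z‖ ^ 2) 0 r := by
  have hzG : DiffContOnCl ℂ (fun z => z * G z) (ball 0 r) := differentiable_id.diffContOnCl.smul hG
  have hzG_cont : ContinuousOn (fun z => z * G z) (sphere 0 r) :=
    hzG.continuousOn_ball.mono sphere_subset_closedBall
  have cross_term_eq_zero : circleAverage (fun z => 2 * inner ℝ c (z * G z)) 0 r = 0 := by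
    have mean_value : circleAverage (fun z => z * G z) 0 r = 0 * G 0 :=
      DiffContOnCl.circleAverage (by rwa [abs_of_pos hr])
    have comp_comm := ((2 : ℝ) • innerSL ℝ c).circleAverage_comp_comm
      (hzG_cont.circleIntegrable hr.le)
    rwa [mean_value, zero_mul, map_zero] at comp_comm
  have integrable_cross : CircleIntegrable (fun z => 2 * inner ℝ c (z * G z)) 0 r :=
    ContinuousOn.circleIntegrable hr.le (by fun_prop)
  have integrable_const : CircleIntegrable (fun _ => ‖c‖ ^ 2) 0 r := circleIntegrable_const _ _ _
  have integrable_sq : CircleIntegrable (fun z => ‖z * G z‖ ^ 2) 0 r :=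
    (hzG_cont.norm.pow 2).circleIntegrable hr.le
  have average_sq : circleAverage (fun z => ‖z * G z‖ ^ 2) 0 r =
      r ^ 2 * circleAverage (fun z => ‖G z‖ ^ 2) 0 r := by
    rw [← smul_eq_mul, ← circleAverage_fun_smul]
    refine circleAverage_congr_sphere fun z hz => ?_
    simp only [norm_mul, mem_sphere_zero_iff_norm.1 hz, mul_pow, sq_abs, smul_eq_mul]
  simp only [norm_add_sq_real]
  rw [circleAverage_fun_add (integrable_const.fun_add integrable_cross) integrable_sq,
    circleAverage_fun_add integrable_const integrable_cross, cross_term_eq_zero, average_sq,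
    circleAverage_const, add_zero]

lemma sum_sq_norm_taylorCoeff_le_circleAverage {F : ℂ → ℂ} {R : ℝ} (hr : 0 < r) (hrR : r < R)
    (hF : DifferentiableOn ℂ F (ball 0 R)) (n : ℕ) :
    ∑ k ∈ Finset.range n, ‖taylorCoeff F k‖ ^ 2 * r ^ (2 * k) ≤
      circleAverage (fun z => ‖F z‖ ^ 2) 0 r := by
  have h0 : ball (0 : ℂ) R ∈ nhds 0 := ball_mem_nhds _ (hr.trans hrR)
  induction n generalizing F with
  | zero => simpa using circleAverage_nonneg_of_nonneg fun z _ => sq_nonneg ‖F z‖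
  | succ n ih =>
    have hD : DifferentiableOn ℂ (dslope F 0) (ball 0 R) :=
      (Complex.differentiableOn_dslope h0).2 hF
    calc ∑ k ∈ Finset.range (n + 1), ‖taylorCoeff F k‖ ^ 2 * r ^ (2 * k)
      _ = ‖F 0‖ ^ 2 +
          r ^ 2 * ∑ k ∈ Finset.range n, ‖taylorCoeff (dslope F 0) k‖ ^ 2 * r ^ (2 * k) := by
        rw [Finset.sum_range_succ', taylorCoeff_zero, add_comm, Finset.mul_sum]
        simp only [taylorCoeff_dslope (hF.analyticAt h0)]
        ring_nf
      _ ≤ ‖F 0‖ ^ 2 + r ^ 2 * circleAverage (fun z => ‖dslope F 0 z‖ ^ 2) 0 r := by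
        gcongr
        exact ih hD
      _ = circleAverage (fun z => ‖F z‖ ^ 2) 0 r := by
        rw [← circleAverage_sq_norm_const_add_mul hr
          (hD.diffContOnCl_ball (closedBall_subset_ball hrR))]
        simp only [← eq_add_mul_dslope]

lemma circleAverage_sq_norm_polynomial_eval (p : Polynomial ℂ) (r : ℝ) :
    circleAverage (fun z => ‖p.eval z‖ ^ 2) 0 r =
      ∑ k ∈ p.support, ‖p.coeff k‖ ^ 2 * r ^ (2 * k) := by
  let q := p.comp (Polynomial.C (r : ℂ) * Polynomial.X)
  have coeff_q (k : ℕ) : q.coeff k = p.coeff k * r ^ k := Polynomial.comp_C_mul_X_coeff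
  have eval_q (z : ℂ) : q.eval z = p.eval (r * z) := by simp [q]
  rw [circleAverage_eq_circleAverage_zero_one]
  simp only [add_zero, ← eval_q, ← q.sum_sq_norm_coeff_eq_circleAverage]
  have support_q : q.support ⊆ p.support := fun k hk => by
    rw [Polynomial.mem_support_iff, coeff_q] at hk
    exact Polynomial.mem_support_iff.2 (left_ne_zero_of_mul hk)
  rw [Finset.sum_subset support_q fun k _ hk => by simp [Polynomial.notMem_support_iff.1 hk]]
  refine Finset.sum_congr rfl fun k _ => ?_
  rw [coeff_q, norm_mul, mul_pow, norm_pow, Complex.norm_real, Real.norm_eq_abs, ← pow_mul,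
    mul_comm k, pow_mul, sq_abs, ← pow_mul]

lemma sum_sq_norm_coeff_taylorSeries_mul_polynomial_le {φ : ℂ → ℂ}
    (hφ : DifferentiableOn ℂ φ (ball 0 1)) (hφ_le : ∀ z ∈ ball 0 1, ‖φ z‖ ≤ 1)
    (p : Polynomial ℂ) (n : ℕ) :
    ∑ k ∈ Finset.range n, ‖coeff k (taylorSeries φ * (p : ℂ⟦X⟧))‖ ^ 2 ≤
      ∑ k ∈ p.support, ‖p.coeff k‖ ^ 2 := by
  have hφp : DifferentiableOn ℂ (fun z => φ z * p.eval z) (ball 0 1) :=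
    hφ.fun_mul p.differentiable.differentiableOn
  have coeff_eq (k : ℕ) : coeff k (taylorSeries φ * (p : ℂ⟦X⟧)) =
      taylorCoeff (fun z => φ z * p.eval z) k := by
    rw [← coeff_taylorSeries, taylorSeries_mul (hφ.analyticAt (ball_mem_nhds _ one_pos))
      (p.differentiable.analyticAt 0), taylorSeries_polynomial_eval]
  simp only [coeff_eq]
  have le_of_lt_one (r : ℝ) (hr : r ∈ Set.Ioo 0 1) :
      ∑ k ∈ Finset.range n, ‖taylorCoeff (fun z => φ z * p.eval z) k‖ ^ 2 * r ^ (2 * k) ≤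
        ∑ k ∈ p.support, ‖p.coeff k‖ ^ 2 := by
    have sphere_subset : sphere (0 : ℂ) r ⊆ ball 0 1 :=
      sphere_subset_closedBall.trans (closedBall_subset_ball hr.2)
    calc _ ≤ circleAverage (fun z => ‖φ z * p.eval z‖ ^ 2) 0 r :=
          sum_sq_norm_taylorCoeff_le_circleAverage hr.1 hr.2 hφp n
      _ ≤ circleAverage (fun z => ‖p.eval z‖ ^ 2) 0 r := by
        refine circleAverage_mono
          (((hφp.continuousOn.mono sphere_subset).norm.pow 2).circleIntegrable hr.1.le)
          (ContinuousOn.circleIntegrable hr.1.le (by fun_prop)) fun z hz => ?_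
        rw [abs_of_pos hr.1] at hz
        rw [norm_mul]
        gcongr
        exact mul_le_of_le_one_left (norm_nonneg _) (hφ_le z (sphere_subset hz))
      _ = ∑ k ∈ p.support, ‖p.coeff k‖ ^ 2 * r ^ (2 * k) :=
        circleAverage_sq_norm_polynomial_eval p r
      _ ≤ ∑ k ∈ p.support, ‖p.coeff k‖ ^ 2 := by
        gcongr
        exact mul_le_of_le_one_right (sq_nonneg _) (pow_le_one₀ hr.1.le hr.2.le)
  have tendsto_one : Tendsto
      (fun r : ℝ => ∑ k ∈ Finset.range n,
        ‖taylorCoeff (fun z => φ z * p.eval z) k‖ ^ 2 * r ^ (2 * k))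
      (𝓝[<] 1) (𝓝 (∑ k ∈ Finset.range n, ‖taylorCoeff (fun z => φ z * p.eval z) k‖ ^ 2)) := by
    refine Tendsto.mono_left (Continuous.tendsto' (by fun_prop) _ _ ?_) nhdsWithin_le_nhds
    simp only [one_pow, mul_one]
  exact le_of_tendsto tendsto_one (eventually_of_mem (Ioo_mem_nhdsLT one_pos) le_of_lt_one)

lemma sum_sq_norm_coeff_taylorSeries_mul_le {φ : ℂ → ℂ} (hφ : DifferentiableOn ℂ φ (ball 0 1))
    (hφ_le : ∀ z ∈ ball 0 1, ‖φ z‖ ≤ 1) (P : ℂ⟦X⟧) (n : ℕ) :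
    ∑ k ∈ Finset.range n, ‖coeff k (taylorSeries φ * P)‖ ^ 2 ≤
      ∑ k ∈ Finset.range n, ‖coeff k P‖ ^ 2 := by
  let p := trunc n P
  have coeff_mul_eq : ∀ k ∈ Finset.range n, coeff k (taylorSeries φ * P) =
      coeff k (taylorSeries φ * (p : ℂ⟦X⟧)) := fun k hk => by
    have hk := Finset.mem_range.1 hk
    rw [← coeff_coe_trunc_of_lt hk, ← trunc_mul_trunc, coeff_coe_trunc_of_lt hk]
  have support_subset : p.support ⊆ Finset.range n := fun k hk => by
    by_contra hkn
    rw [Finset.mem_range] at hkn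
    exact Polynomial.mem_support_iff.1 hk (by rw [coeff_trunc, if_neg hkn])
  calc ∑ k ∈ Finset.range n, ‖coeff k (taylorSeries φ * P)‖ ^ 2
    _ = ∑ k ∈ Finset.range n, ‖coeff k (taylorSeries φ * (p : ℂ⟦X⟧))‖ ^ 2 :=
      Finset.sum_congr rfl fun k hk => by rw [coeff_mul_eq k hk]
    _ ≤ ∑ k ∈ p.support, ‖p.coeff k‖ ^ 2 :=
      sum_sq_norm_coeff_taylorSeries_mul_polynomial_le hφ hφ_le p n
    _ ≤ ∑ k ∈ Finset.range n, ‖p.coeff k‖ ^ 2 :=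
      Finset.sum_le_sum_of_subset_of_nonneg support_subset fun _ _ _ => sq_nonneg _
    _ = ∑ k ∈ Finset.range n, ‖coeff k P‖ ^ 2 :=
      Finset.sum_congr rfl fun k hk => by rw [coeff_trunc, if_pos (by grind)]

lemma differentiableOn_dslope_schwarz {w : ℂ → ℂ} (hw : IsSchwarzFunction w) :
    DifferentiableOn ℂ (dslope w 0) (ball 0 1) :=
  (Complex.differentiableOn_dslope (ball_mem_nhds _ one_pos)).2 hw.1

lemma norm_dslope_schwarz_le_one {w : ℂ → ℂ} (hw : IsSchwarzFunction w) {z : ℂ}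
    (hz : z ∈ ball 0 1) : ‖dslope w 0 z‖ ≤ 1 := by
  have mapsTo : Set.MapsTo w (ball 0 1) (closedBall (w 0) 1) := fun z hz => by
    rw [hw.2.1, mem_closedBall_zero_iff]
    exact (hw.2.2 z hz).trans (mem_ball_zero_iff.1 hz).le
  simpa using Complex.norm_dslope_le_div_of_mapsTo_ball hw.1 mapsTo hz

lemma analyticAt_comp_schwarz {h w : ℂ → ℂ} (hh : AnalyticAt ℂ h 0) (hw : IsSchwarzFunction w) :
    AnalyticAt ℂ (fun z => h (w z)) 0 :=
  AnalyticAt.fun_comp (by rwa [hw.2.1]) (hw.1.analyticAt (ball_mem_nhds _ one_pos))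

/-- **Rogosinski's inequality**. -/
theorem sum_sq_norm_taylorCoeff_comp_le {h w : ℂ → ℂ} (hh : AnalyticAt ℂ h 0)
    (hw : IsSchwarzFunction w) (n : ℕ) :
    ∑ k ∈ Finset.range n, ‖taylorCoeff (fun z => h (w z)) k‖ ^ 2 ≤
      ∑ k ∈ Finset.range n, ‖taylorCoeff h k‖ ^ 2 := by
  have hw_an : AnalyticAt ℂ w 0 := hw.1.analyticAt (ball_mem_nhds _ one_pos)
  induction n generalizing h with
  | zero => simp
  | succ n ih =>
    have coeff_succ (k : ℕ) : taylorCoeff (fun z => h (w z)) (k + 1) =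
        coeff k (taylorSeries (dslope w 0) * taylorSeries fun z => dslope h 0 (w z)) := by
      rw [← coeff_taylorSeries, taylorSeries_comp hh hw_an hw.2.1, map_add, coeff_succ_X_mul,
        coeff_C, if_neg k.succ_ne_zero, zero_add]
    rw [Finset.sum_range_succ', Finset.sum_range_succ' (fun k => ‖taylorCoeff h k‖ ^ 2)]
    simp only [taylorCoeff_zero, hw.2.1, coeff_succ, ← taylorCoeff_dslope hh]
    refine add_le_add_left ?_ _
    calc _ ≤ ∑ k ∈ Finset.range n, ‖coeff k (taylorSeries fun z => dslope h 0 (w z))‖ ^ 2 :=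
          sum_sq_norm_coeff_taylorSeries_mul_le (differentiableOn_dslope_schwarz hw)
            (fun _ => norm_dslope_schwarz_le_one hw) _ n
      _ ≤ ∑ k ∈ Finset.range n, ‖taylorCoeff (dslope h 0) k‖ ^ 2 := by
        simpa only [coeff_taylorSeries] using ih (analyticAt_dslope hh)

lemma sum_sq_norm_taylorCoeff_succ_comp_le {h w : ℂ → ℂ} (hh : AnalyticAt ℂ h 0)
    (hw : IsSchwarzFunction w) (n : ℕ) :
    ∑ k ∈ Finset.range n, ‖taylorCoeff (fun z => h (w z)) (k + 1)‖ ^ 2 ≤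
      ∑ k ∈ Finset.range n, ‖taylorCoeff h (k + 1)‖ ^ 2 := by
  simpa only [Finset.sum_range_succ', taylorCoeff_zero, hw.2.1, add_le_add_iff_right] using
    sum_sq_norm_taylorCoeff_comp_le hh hw (n + 1)

end CircleAverage

section LogarithmicDerivative

open PowerSeries

variable {𝕜 : Type*} [RCLike 𝕜] {G Q : 𝕜⟦X⟧} {S : ℝ} {N n : ℕ}

lemma sq_norm_coeff_mul_le (F Q : 𝕜⟦X⟧) (n : ℕ) :
    ‖coeff n (F * Q)‖ ^ 2 ≤ (∑ k ∈ Finset.range (n + 1), ‖coeff k F‖ ^ 2) *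
      ∑ k ∈ Finset.range (n + 1), ‖coeff k Q‖ ^ 2 := by
  rw [coeff_mul, Finset.Nat.sum_antidiagonal_eq_sum_range_succ_mk]
  calc ‖∑ k ∈ Finset.range (n + 1), coeff k F * coeff (n - k) Q‖ ^ 2
    _ ≤ (∑ k ∈ Finset.range (n + 1), ‖coeff k F‖ * ‖coeff (n - k) Q‖) ^ 2 := by
      gcongr
      exact norm_sum_le_of_le _ fun k _ => norm_mul_le _ _
    _ ≤ (∑ k ∈ Finset.range (n + 1), ‖coeff k F‖ ^ 2) *
        ∑ k ∈ Finset.range (n + 1), ‖coeff (n - k) Q‖ ^ 2 :=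
      Finset.sum_mul_sq_le_sq_mul_sq _ _ _
    _ = _ := by
      congr 1
      exact Finset.sum_range_reflect (fun k => ‖coeff k Q‖ ^ 2) (n + 1)

lemma sq_norm_coeff_succ_le_of_derivative_eq_mul (hG : d⁄dX 𝕜 G = G * Q)
    (hQ : ∑ k ∈ Finset.range N, ‖coeff k Q‖ ^ 2 ≤ S) (hn : n < N) :
    ‖coeff (n + 1) G‖ ^ 2 ≤ S / (n + 1) ^ 2 * ∑ k ∈ Finset.range (n + 1), ‖coeff k G‖ ^ 2 := by
  have norm_coeff : ‖coeff n (G * Q)‖ = ‖coeff (n + 1) G‖ * (n + 1) := by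
    rw [← hG, coeff_derivative, norm_mul]
    exact_mod_cast congrArg _ (RCLike.norm_natCast (K := 𝕜) (n + 1))
  have sum_Q_le : ∑ k ∈ Finset.range (n + 1), ‖coeff k Q‖ ^ 2 ≤ S :=
    (Finset.sum_le_sum_of_subset_of_nonneg (Finset.range_subset_range.2 hn)
      fun _ _ _ => sq_nonneg _).trans hQ
  rw [div_mul_eq_mul_div, le_div_iff₀ (by positivity), ← mul_pow, ← norm_coeff, mul_comm S]
  exact (sq_norm_coeff_mul_le G Q n).trans (by gcongr)

/-- The solution `m` of `m 0 = 1`, `(n + 1) ^ 2 * m (n + 1) = S * (m 0 + ⋯ + m n)`. It majorizes the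
squared moduli of the coefficients of a power series `G = 1 + ⋯` whose logarithmic derivative has
squared `ℓ²`-norm at most `S`. -/
noncomputable def sqCoeffMajorant (S : ℝ) : ℕ → ℝ
  | 0 => 1
  | n + 1 => S / (n + 1) ^ 2 * ∏ k ∈ Finset.range n, (1 + S / (k + 1) ^ 2)

lemma sum_range_succ_sqCoeffMajorant (S : ℝ) (n : ℕ) :
    ∑ k ∈ Finset.range (n + 1), sqCoeffMajorant S k =
      ∏ k ∈ Finset.range n, (1 + S / (k + 1) ^ 2) := by
  induction n with
  | zero => simp [sqCoeffMajorant]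
  | succ n ih =>
    rw [Finset.sum_range_succ, ih, Finset.prod_range_succ, sqCoeffMajorant]
    ring

lemma sq_norm_coeff_le_sqCoeffMajorant (hG : d⁄dX 𝕜 G = G * Q) (hG0 : coeff 0 G = 1)
    (hQ : ∑ k ∈ Finset.range N, ‖coeff k Q‖ ^ 2 ≤ S) (hn : n ≤ N) :
    ‖coeff n G‖ ^ 2 ≤ sqCoeffMajorant S n := by
  have hS : 0 ≤ S := (Finset.sum_nonneg fun _ _ => sq_nonneg _).trans hQ
  induction n using Nat.strong_induction_on with
  | h n ih =>
    cases n with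
    | zero => simp [hG0, sqCoeffMajorant]
    | succ n =>
      calc ‖coeff (n + 1) G‖ ^ 2
        _ ≤ S / (n + 1) ^ 2 * ∑ k ∈ Finset.range (n + 1), ‖coeff k G‖ ^ 2 :=
          sq_norm_coeff_succ_le_of_derivative_eq_mul hG hQ hn
        _ ≤ S / (n + 1) ^ 2 * ∑ k ∈ Finset.range (n + 1), sqCoeffMajorant S k := by
          gcongr with k hk
          have hk := Finset.mem_range.1 hk
          exact ih k hk (by omega)
        _ = sqCoeffMajorant S (n + 1) := by
          rw [sum_range_succ_sqCoeffMajorant, sqCoeffMajorant]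

end LogarithmicDerivative

section Hadamard

open InnerProductSpace

variable {𝕜 n : Type*} [RCLike 𝕜] [Fintype n] [DecidableEq n]

lemma norm_orthonormalBasis_det_eq {E : Type*} [NormedAddCommGroup E] [InnerProductSpace 𝕜 E]
    (b b' : OrthonormalBasis n 𝕜 E) (v : n → E) : ‖b.toBasis.det v‖ = ‖b'.toBasis.det v‖ := by
  rw [b.toBasis.det.eq_smul_basis_det b'.toBasis, AlternatingMap.smul_apply, norm_smul,
    b'.coe_toBasis, b.det_to_matrix_orthonormalBasis, one_mul]

lemma norm_orthonormalBasis_det_le_prod_norm {E : Type*} [NormedAddCommGroup E]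
    [InnerProductSpace 𝕜 E] (b : OrthonormalBasis n 𝕜 E) (v : n → E) :
    ‖b.toBasis.det v‖ ≤ ∏ i, ‖v i‖ := by
  let e := Fintype.equivFin n
  have : FiniteDimensional 𝕜 E := b.toBasis.finiteDimensional_of_finite
  let g := gramSchmidtOrthonormalBasis
    (Module.finrank_eq_card_basis (b.reindex e).toBasis) (v ∘ e.symm)
  rw [norm_orthonormalBasis_det_eq b (g.reindex e.symm), OrthonormalBasis.reindex_toBasis,
    Module.Basis.det_reindex, gramSchmidtOrthonormalBasis_det, norm_prod, ← e.symm.prod_comp]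
  gcongr with i
  simpa [g.norm_eq_one i] using norm_inner_le_norm (𝕜 := 𝕜) (g i) (v (e.symm i))

/-- **Hadamard's inequality**. -/
theorem sq_norm_det_le_prod_sum_sq_norm (A : Matrix n n 𝕜) :
    ‖A.det‖ ^ 2 ≤ ∏ i, ∑ j, ‖A i j‖ ^ 2 := by
  have det_eq : A.det =
      (EuclideanSpace.basisFun n 𝕜).toBasis.det fun i => WithLp.toLp 2 (A i) := by
    rw [← Matrix.det_transpose, Module.Basis.det_apply]
    rfl
  calc ‖A.det‖ ^ 2 ≤ (∏ i, ‖WithLp.toLp 2 (A i)‖) ^ 2 := by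
        rw [det_eq]
        gcongr
        exact norm_orthonormalBasis_det_le_prod_norm _ _
    _ = ∏ i, ∑ j, ‖A i j‖ ^ 2 := by simp only [← Finset.prod_pow, EuclideanSpace.norm_sq_eq]

end Hadamard

section StarlikeClass

open Filter PowerSeries Topology

/-- The Ma–Minda class `𝒮*(φ)` of functions `f` in `𝒜` without zeros in the punctured disk whose
quotient `z f'(z) / f(z)` is subordinate to `φ`. -/
def StarlikeClass (φ : ℂ → ℂ) : Set (ℂ → ℂ) :=
  {f | f ∈ ClassA ∧ (∀ z ∈ ball (0 : ℂ) 1, z ≠ 0 → f z ≠ 0) ∧ Subordinate (starlikeQuotient f) φ}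

variable {φ f : ℂ → ℂ}

lemma taylorSeries_eq_X_mul_dslope (hf : f ∈ ClassA) :
    taylorSeries f = X * taylorSeries (dslope f 0) := by
  rw [taylorSeries_eq_C_add_X_mul (hf.1.analyticAt (ball_mem_nhds _ one_pos)), hf.2.1, map_zero,
    zero_add]

lemma derivative_taylorSeries_dslope_eq_mul {p : ℂ → ℂ} (hp : AnalyticAt ℂ p 0)
    (hf : f ∈ ClassA) (hf_ne : ∀ z ∈ ball (0 : ℂ) 1, z ≠ 0 → f z ≠ 0)
    (hfp : ∀ z ∈ ball (0 : ℂ) 1, starlikeQuotient f z = p z) :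
    d⁄dX ℂ (taylorSeries (dslope f 0)) =
      taylorSeries (dslope f 0) * taylorSeries (dslope p 0) := by
  have h0 : ball (0 : ℂ) 1 ∈ 𝓝 0 := ball_mem_nhds _ one_pos
  have hf_an : AnalyticAt ℂ f 0 := hf.1.analyticAt h0
  have p_zero : p 0 = 1 := by
    rw [← hfp 0 (mem_ball_self one_pos), starlikeQuotient, Function.update_self]
  have mul_deriv_eq : (fun z => z * deriv f z) =ᶠ[𝓝 0] fun z => f z * p z := by
    filter_upwards [h0] with z hz
    rcases eq_or_ne z 0 with rfl | hz0
    · simp [hf.2.1]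
    · rw [← hfp z hz, starlikeQuotient, Function.update_of_ne hz0,
        mul_div_cancel₀ _ (hf_ne z hz hz0)]
  have series_eq := taylorSeries_congr mul_deriv_eq
  rw [taylorSeries_id_mul hf_an.deriv, taylorSeries_deriv, taylorSeries_mul hf_an hp,
    taylorSeries_eq_C_add_X_mul hp, p_zero, taylorSeries_eq_X_mul_dslope hf] at series_eq
  simp only [Derivation.leibniz, derivative_X, smul_eq_mul, map_one] at series_eq
  refine mul_left_cancel₀ (pow_ne_zero 2 (X_ne_zero (R := ℂ))) ?_
  linear_combination series_eq

theorem sq_norm_taylorCoeff_succ_le_sqCoeffMajorant {S : ℝ} {N n : ℕ} (hφ : AnalyticAt ℂ φ 0)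
    (hS : ∑ k ∈ Finset.range N, ‖taylorCoeff φ (k + 1)‖ ^ 2 ≤ S) (hf : f ∈ StarlikeClass φ)
    (hn : n ≤ N) : ‖taylorCoeff f (n + 1)‖ ^ 2 ≤ sqCoeffMajorant S n := by
  obtain ⟨hfA, hf_ne, w, hw, hsub⟩ := hf
  have hφw := analyticAt_comp_schwarz hφ hw
  have hG := derivative_taylorSeries_dslope_eq_mul hφw hfA hf_ne hsub
  have hG0 : coeff 0 (taylorSeries (dslope f 0)) = 1 := by
    rw [coeff_taylorSeries, taylorCoeff_zero, dslope_same, hfA.2.2]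
  have hQ : ∑ k ∈ Finset.range N, ‖coeff k (taylorSeries (dslope (fun z => φ (w z)) 0))‖ ^ 2
      ≤ S := by
    simpa only [coeff_taylorSeries, taylorCoeff_dslope hφw] using
      (sum_sq_norm_taylorCoeff_succ_comp_le hφ hw N).trans hS
  have hf_an : AnalyticAt ℂ f 0 := hfA.1.analyticAt (ball_mem_nhds _ one_pos)
  simpa only [coeff_taylorSeries, taylorCoeff_dslope hf_an] using
    sq_norm_coeff_le_sqCoeffMajorant hG hG0 hQ hn

theorem sq_norm_hankelDet_one_le {S : ℝ} {q : ℕ} (hφ : AnalyticAt ℂ φ 0)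
    (hS : ∑ k ∈ Finset.range (2 * q), ‖taylorCoeff φ (k + 1)‖ ^ 2 ≤ S)
    (hf : f ∈ StarlikeClass φ) :
    ‖hankelDet f (q + 1) 1‖ ^ 2 ≤
      ∏ i ∈ Finset.range (q + 1), ∑ j ∈ Finset.range (q + 1), sqCoeffMajorant S (i + j) := by
  simp only [Finset.prod_range, Finset.sum_range]
  refine (sq_norm_det_le_prod_sum_sq_norm _).trans ?_
  gcongr with i _ j _
  rw [Matrix.of_apply, add_assoc, add_comm 1]
  exact sq_norm_taylorCoeff_succ_le_sqCoeffMajorant hφ hS hf (by omega)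

end StarlikeClass

section Bean

open Filter PowerSeries Topology

lemma analyticAt_tanh_zero : AnalyticAt ℂ Complex.tanh 0 := by
  simp only [funext Complex.tanh_eq_sinh_div_cosh]
  exact (Complex.differentiable_sinh.analyticAt 0).fun_div
    (Complex.differentiable_cosh.analyticAt 0) (by simp)

lemma deriv_tanh_eventuallyEq : deriv Complex.tanh =ᶠ[𝓝 0] fun z => 1 - Complex.tanh z ^ 2 := by
  have cosh_ne : ∀ᶠ z in 𝓝 (0 : ℂ), Complex.cosh z ≠ 0 :=
    Complex.continuous_cosh.continuousAt.eventually_ne (by simp)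
  filter_upwards [cosh_ne] with z hz
  have deriv_div := ((Complex.hasDerivAt_sinh z).fun_div (Complex.hasDerivAt_cosh z) hz).deriv
  simp only [← Complex.tanh_eq_sinh_div_cosh] at deriv_div
  rw [deriv_div, Complex.tanh_eq_sinh_div_cosh]
  field_simp

lemma derivative_taylorSeries_tanh :
    d⁄dX ℂ (taylorSeries Complex.tanh) = 1 - taylorSeries Complex.tanh ^ 2 := by
  have h := analyticAt_tanh_zero
  have deriv_add_sq : (fun z => deriv Complex.tanh z + Complex.tanh z * Complex.tanh z) =ᶠ[𝓝 0]
      fun _ => 1 := by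
    filter_upwards [deriv_tanh_eventuallyEq] with z hz
    rw [hz]
    ring
  rw [eq_sub_iff_add_eq, ← taylorSeries_deriv, sq, ← taylorSeries_mul h h,
    ← taylorSeries_add h.deriv (h.fun_mul h), taylorSeries_congr deriv_add_sq,
    taylorSeries_const, map_one]

lemma beanFunction_sq (z : ℂ) : beanFunction z ^ 2 = 1 + Complex.tanh z :=
  Complex.cpow_nat_inv_pow _ two_ne_zero

lemma beanFunction_zero : beanFunction 0 = 1 := by
  simp [beanFunction]

lemma analyticAt_beanFunction_zero : AnalyticAt ℂ beanFunction 0 :=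
  (analyticAt_const.fun_add analyticAt_tanh_zero).cpow analyticAt_const (by simp)

lemma taylorSeries_beanFunction_sq :
    taylorSeries beanFunction ^ 2 = 1 + taylorSeries Complex.tanh := by
  rw [sq, ← taylorSeries_mul analyticAt_beanFunction_zero analyticAt_beanFunction_zero]
  simp only [← sq, beanFunction_sq]
  rw [taylorSeries_add analyticAt_const analyticAt_tanh_zero, taylorSeries_const, map_one]

/-- Differentiating `B ^ 2 = 1 + T` and substituting `T' = 1 - T ^ 2 = B ^ 2 * (2 - B ^ 2)`. -/
lemma derivative_taylorSeries_beanFunction :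
    2 * d⁄dX ℂ (taylorSeries beanFunction) =
      2 * taylorSeries beanFunction - taylorSeries beanFunction ^ 3 := by
  set B := taylorSeries beanFunction with hB
  have B_ne : B ≠ 0 := fun h => by
    simpa [hB, taylorCoeff_zero, beanFunction_zero] using congrArg (coeff 0) h
  have tanh_eq : taylorSeries Complex.tanh = B ^ 2 - 1 :=
    eq_sub_of_add_eq' taylorSeries_beanFunction_sq.symm
  have two_mul_derivative : 2 * B * d⁄dX ℂ B = 1 - (B ^ 2 - 1) ^ 2 := by
    rw [← tanh_eq, ← derivative_taylorSeries_tanh, tanh_eq]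
    simp only [map_sub, Derivation.leibniz_pow, Nat.add_one_sub_one, pow_one, smul_eq_mul,
      nsmul_eq_mul, Nat.cast_ofNat, Derivation.map_one_eq_zero, sub_zero]
    ring
  refine mul_left_cancel₀ B_ne ?_
  linear_combination two_mul_derivative

lemma taylorCoeff_beanFunction_succ (n : ℕ) :
    taylorCoeff beanFunction (n + 1) = (taylorCoeff beanFunction n -
      (∑ i ∈ Finset.range (n + 1), (∑ j ∈ Finset.range (i + 1),
        taylorCoeff beanFunction j * taylorCoeff beanFunction (i - j)) *
          taylorCoeff beanFunction (n - i)) / 2) / (n + 1) := by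
  have coeff_eq := congrArg (coeff n) derivative_taylorSeries_beanFunction
  rw [← map_ofNat (C (R := ℂ)) 2, map_sub, coeff_C_mul, coeff_C_mul, coeff_derivative] at coeff_eq
  simp only [pow_succ, pow_zero, one_mul, coeff_mul, coeff_taylorSeries,
    Finset.Nat.sum_antidiagonal_eq_sum_range_succ_mk] at coeff_eq
  rw [eq_div_iff n.cast_add_one_ne_zero]
  linear_combination coeff_eq / 2

lemma taylorCoeff_beanFunction :
    taylorCoeff beanFunction 1 = 1 / 2 ∧
    taylorCoeff beanFunction 2 = -1 / 8 ∧ taylorCoeff beanFunction 3 = -5 / 48 ∧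
    taylorCoeff beanFunction 4 = 17 / 384 ∧ taylorCoeff beanFunction 5 = 121 / 3840 ∧
    taylorCoeff beanFunction 6 = -721 / 46080 := by
  have b0 : taylorCoeff beanFunction 0 = 1 := by rw [taylorCoeff_zero, beanFunction_zero]
  have b1 : taylorCoeff beanFunction 1 = 1 / 2 :=
    (taylorCoeff_beanFunction_succ 0).trans (by norm_num [Finset.sum_range_succ, b0])
  have b2 : taylorCoeff beanFunction 2 = -1 / 8 :=
    (taylorCoeff_beanFunction_succ 1).trans (by norm_num [Finset.sum_range_succ, b0, b1])
  have b3 : taylorCoeff beanFunction 3 = -5 / 48 :=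
    (taylorCoeff_beanFunction_succ 2).trans (by norm_num [Finset.sum_range_succ, b0, b1, b2])
  have b4 : taylorCoeff beanFunction 4 = 17 / 384 :=
    (taylorCoeff_beanFunction_succ 3).trans (by norm_num [Finset.sum_range_succ, b0, b1, b2, b3])
  have b5 : taylorCoeff beanFunction 5 = 121 / 3840 :=
    (taylorCoeff_beanFunction_succ 4).trans
      (by norm_num [Finset.sum_range_succ, b0, b1, b2, b3, b4])
  have b6 : taylorCoeff beanFunction 6 = -721 / 46080 :=
    (taylorCoeff_beanFunction_succ 5).trans
      (by norm_num [Finset.sum_range_succ, b0, b1, b2, b3, b4, b5])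
  exact ⟨b1, b2, b3, b4, b5, b6⟩

lemma sum_sq_norm_taylorCoeff_beanFunction_le :
    ∑ k ∈ Finset.range 6, ‖taylorCoeff beanFunction (k + 1)‖ ^ 2 ≤ 9 / 25 := by
  obtain ⟨b1, b2, b3, b4, b5, b6⟩ := taylorCoeff_beanFunction
  norm_num [Finset.sum_range_succ, b1, b2, b3, b4, b5, b6]

end Bean

theorem mainTheorem6_general {φ f : ℂ → ℂ} (hφ : AnalyticAt ℂ φ 0)
    (hS : ∑ k ∈ Finset.range 6, ‖taylorCoeff φ (k + 1)‖ ^ 2 ≤ 9 / 25) (hf : f ∈ StarlikeClass φ) :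
    ‖hankelDet f 4 1‖ ≤ 0.169251 := by
  refine le_of_sq_le_sq ((sq_norm_hankelDet_one_le (q := 3) hφ hS hf).trans ?_) (by norm_num)
  norm_num [Finset.prod_range_succ, Finset.sum_range_succ, sqCoeffMajorant]

theorem mainTheorem6 (f : ℂ → ℂ) (hf : f ∈ StarlikeBean) :
    ‖hankelDet f 4 1‖ ≤ 0.169251 :=
  mainTheorem6_general analyticAt_beanFunction_zero sum_sq_norm_taylorCoeff_beanFunction_le hf
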